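/- For real $s>0$ let $\eta(s)=\sum_{n\ge 1}\frac{(-1)^{n-1}}{n^{s}}$ be the Dirichlet eta function, and let $\zeta$ be the Riemann zeta function. Then the following series converges and $$\zeta(3)=\frac{\pi^2}{7}\Bigl(\ln\frac{\pi}{2}-\frac12+\sum_{j=1}^{\infty}\frac{\eta(2j)}{j(j+1)}\Bigr).$$ Moreover, for every $0<x\le \pi/2$ the function $t\mapsto t\ln(\tan t)$ is integrable on $[0,x]$ and $$\frac87\int_0^x t\ln(\tan t)\,dt=\frac87\Bigl(\frac14\bigl(2\ln x-1\bigr)x^2+\sum_{j=1}^{\infty}\frac{2^{2j-1}}{\pi^{2j}\,j(j+1)}\,\eta(2j)\,x^{2j+2}\Bigr)$$ with a convergent series, and at $x=\pi/2$ the left-hand side equals $\zeta(3)$: $$\zeta(3)=\frac87\int_0^{\pi/2}t\ln(\tan t)\,dt.$$ -/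

import Mathlib

open Filter Topology

/-- The Dirichlet eta function at real arguments `s > 0`: the sum
`∑_{n ≥ 1} (-1) ^ (n - 1) / n ^ s`, as the limit of its partial sums, since the convergence is
only conditional when `s ≤ 1`. -/
noncomputable def dirichletEta (s : ℝ) : ℝ :=
  limUnder atTop (fun N : ℕ => ∑ n ∈ Finset.range N, (-1 : ℝ) ^ n / ((n : ℝ) + 1) ^ s)

/-- The defining series does converge to `dirichletEta s` for every `s > 0`. -/
theorem tendsto_dirichletEta {s : ℝ} (hs : 0 < s) :
    Tendsto (fun N : ℕ => ∑ n ∈ Finset.range N, (-1 : ℝ) ^ n / ((n : ℝ) + 1) ^ s) atTop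
      (𝓝 (dirichletEta s)) := by
  have hanti : Antitone (fun n : ℕ => (((n : ℝ) + 1) ^ s)⁻¹) := by
    intro m n hmn
    have h : (m : ℝ) ≤ n := by exact_mod_cast hmn
    have hm : (0 : ℝ) < (m : ℝ) + 1 := by positivity
    exact inv_anti₀ (Real.rpow_pos_of_pos hm s)
      (Real.rpow_le_rpow hm.le (by linarith) hs.le)
  have hlim : Tendsto (fun n : ℕ => (((n : ℝ) + 1) ^ s)⁻¹) atTop (𝓝 0) :=
    ((tendsto_rpow_atTop hs).comp
      (tendsto_atTop_add_const_right _ 1 tendsto_natCast_atTop_atTop)).inv_tendsto_atTop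
  obtain ⟨l, hl⟩ := hanti.tendsto_alternating_series_of_tendsto_zero hlim
  exact tendsto_nhds_limUnder ⟨l, by simpa only [div_eq_mul_inv] using hl⟩

/-! Two computations of `∫ t log (tan t)` meet at `π / 2`. Taking logarithms in Euler's sine product
expands `log (sin t / t)` in even zeta values; since `tan t = 2 sin² t / sin 2t`, the coefficients
for `log (tan t / t)` combine to `(4 ^ j - 2) ζ(2j) = 4 ^ j η(2j)`. They are nonnegative, so
integration against `t` is termwise up to `π / 2` included (`hasSum_integral_mul_log_tan`). On the
other side, `∑ cos (2nt) / n²` is the quadratic `t² - πt + π² / 6`. Up to a part symmetric about `π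
/ 4`, to which `log (tan t)` is orthogonal, this is `-(π / 2) t`. The cosine coefficients of `log
(tan t)` are `-(π / 2) / n` for odd `n` and `0` for even `n ≠ 0`, so the integral is `∑ 1 / n³` over
odd `n`, that is `7/8 ζ(3)`. -/

/-! ### Power series of `log (tan t / t)`. -/

/-- The even zeta values `∑ 1 / (n + 1) ^ (2 k)`. -/
noncomputable def evenZeta (k : ℕ) : ℝ := ∑' n : ℕ, 1 / ((n : ℝ) + 1) ^ (2 * k)

theorem hasSum_evenZeta {k : ℕ} (hk : 1 ≤ k) :
    HasSum (fun n : ℕ => 1 / ((n : ℝ) + 1) ^ (2 * k)) (evenZeta k) := by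
  have h : Summable (fun n : ℕ => 1 / (n : ℝ) ^ (2 * k)) :=
    Real.summable_one_div_nat_pow.2 (by omega)
  have h' := (summable_nat_add_iff 1).2 h
  simp only [Nat.cast_add, Nat.cast_one] at h'
  exact h'.hasSum

theorem evenZeta_nonneg (k : ℕ) : 0 ≤ evenZeta k :=
  tsum_nonneg fun n => by positivity

/-- Interchange of the two sums for a doubly indexed family of nonnegative reals. -/
theorem hasSum_comm_of_nonneg {f : ℕ → ℕ → ℝ} (hf : ∀ i j, 0 ≤ f i j) {g h : ℕ → ℝ} {a : ℝ}
    (hg : ∀ i, HasSum (f i) (g i)) (ha : HasSum g a)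
    (hh : ∀ j, HasSum (fun i => f i j) (h j)) : HasSum h a := by
  have hs : Summable (Function.uncurry f) := by
    refine (summable_prod_of_nonneg (f := Function.uncurry f) fun p => hf p.1 p.2).2
      ⟨fun i => (hg i).summable, ?_⟩
    simpa only [Function.uncurry_apply_pair, (hg _).tsum_eq] using ha.summable
  have h1 : HasSum (Function.uncurry f) a := by
    have := hs.hasSum.prod_fiberwise hg
    rw [ha.unique this]
    exact hs.hasSum
  have h2 : HasSum (Function.uncurry f ∘ Equiv.prodComm ℕ ℕ) a :=
    (Equiv.hasSum_iff (Equiv.prodComm ℕ ℕ)).2 h1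
  exact h2.prod_fiberwise hh

/-- Logarithm of Euler's sine product; the terms are nonnegative, so convergence of the partial sums
suffices. -/
theorem hasSum_log_one_sub_sq {y : ℝ} (hy : 0 < y) (hy1 : y < 1) :
    HasSum (fun n : ℕ => -Real.log (1 - y ^ 2 / ((n : ℝ) + 1) ^ 2))
      (-(Real.log (Real.sin (Real.pi * y)) - Real.log (Real.pi * y))) := by
  have hlt : ∀ n : ℕ, y ^ 2 / ((n : ℝ) + 1) ^ 2 < 1 := by
    intro n
    rw [div_lt_one (by positivity)]
    have : (0 : ℝ) ≤ n := n.cast_nonneg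
    gcongr
    linarith
  have hpos : ∀ n : ℕ, 0 < 1 - y ^ 2 / ((n : ℝ) + 1) ^ 2 := fun n => by linarith [hlt n]
  have hpy : 0 < Real.pi * y := mul_pos Real.pi_pos hy
  have hsin : 0 < Real.sin (Real.pi * y) :=
    Real.sin_pos_of_pos_of_lt_pi hpy (by nlinarith [Real.pi_pos])
  rw [hasSum_iff_tendsto_nat_of_nonneg]
  · have h := ((Real.tendsto_euler_sin_prod y).log hsin.ne').sub_const (Real.log (Real.pi * y))
    refine h.neg.congr fun n => ?_
    rw [Real.log_mul hpy.ne' (Finset.prod_ne_zero_iff.2 fun i _ => (hpos i).ne'),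
      Real.log_prod fun i _ => (hpos i).ne', Finset.sum_neg_distrib]
    ring
  · intro n
    have : 0 ≤ y ^ 2 / ((n : ℝ) + 1) ^ 2 := by positivity
    exact neg_nonneg.2 (Real.log_nonpos (hpos n).le (by linarith))

/-- The power series of `log (sin (π y) / (π y))`. -/
theorem hasSum_log_sin {y : ℝ} (hy : 0 < y) (hy1 : y < 1) :
    HasSum (fun j : ℕ => evenZeta (j + 1) * (y ^ (2 * (j + 1)) / ((j : ℝ) + 1)))
      (-(Real.log (Real.sin (Real.pi * y)) - Real.log (Real.pi * y))) := by
  refine hasSum_comm_of_nonneg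
    (f := fun n j : ℕ => (y ^ 2 / ((n : ℝ) + 1) ^ 2) ^ (j + 1) / ((j : ℝ) + 1))
    (fun n j => by positivity) (fun n => ?_) (hasSum_log_one_sub_sq hy hy1) (fun j => ?_)
  · refine Real.hasSum_pow_div_log_of_abs_lt_one ?_
    rw [abs_of_nonneg (by positivity), div_lt_one (by positivity)]
    have : (0 : ℝ) ≤ n := n.cast_nonneg
    gcongr
    linarith
  · refine ((hasSum_evenZeta (k := j + 1) (by omega)).mul_right
      (y ^ (2 * (j + 1)) / ((j : ℝ) + 1))).congr_fun ?_
    intro n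
    rw [div_pow, ← pow_mul, ← pow_mul]
    field_simp

theorem dirichletEta_two_mul {k : ℕ} (hk : 1 ≤ k) :
    dirichletEta (2 * (k : ℝ)) = (1 - 2 / 4 ^ k) * evenZeta k := by
  have hZ := hasSum_evenZeta hk
  -- Index `n` stands for the integer `n + 1`, so odd indices carry the even integers.
  have hodd : HasSum (fun n : ℕ => 1 / (((2 * n + 1 : ℕ) : ℝ) + 1) ^ (2 * k))
      (evenZeta k / 4 ^ k) := by
    refine (hZ.div_const (4 ^ k)).congr_fun fun n => ?_
    have : (((2 * n + 1 : ℕ) : ℝ) + 1) ^ (2 * k) = 4 ^ k * ((n : ℝ) + 1) ^ (2 * k) := by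
      rw [show (((2 * n + 1 : ℕ) : ℝ) + 1) = 2 * ((n : ℝ) + 1) by push_cast; ring, mul_pow,
        pow_mul 2 2 k]
      norm_num
    rw [this]
    field_simp
  have heven : HasSum (fun n : ℕ => 1 / (((2 * n : ℕ) : ℝ) + 1) ^ (2 * k))
      (evenZeta k - evenZeta k / 4 ^ k) := by
    have hs : Summable (fun n : ℕ => 1 / (((2 * n : ℕ) : ℝ) + 1) ^ (2 * k)) :=
      hZ.summable.comp_injective (i := fun n : ℕ => 2 * n) fun a b h => by simpa using h
    have := (HasSum.even_add_odd (f := fun n : ℕ => 1 / ((n : ℝ) + 1) ^ (2 * k)) hs.hasSum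
      hodd).unique hZ
    rw [← eq_sub_of_add_eq this]
    exact hs.hasSum
  have hsum : HasSum (fun n : ℕ => (-1 : ℝ) ^ n / ((n : ℝ) + 1) ^ (2 * (k : ℝ)))
      (evenZeta k - evenZeta k / 4 ^ k + -(evenZeta k / 4 ^ k)) := by
    have hr : ∀ n : ℕ, ((n : ℝ) + 1) ^ (2 * (k : ℝ)) = ((n : ℝ) + 1) ^ (2 * k) := fun n => by
      rw [← Real.rpow_natCast]; push_cast; rfl
    simp only [hr]
    refine HasSum.even_add_odd (heven.congr_fun fun n => ?_) (hodd.neg.congr_fun fun n => ?_)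
    · rw [pow_mul]; simp
    · rw [pow_succ, pow_mul]; simp [neg_div]
  have hk' : (0 : ℝ) < 2 * (k : ℝ) := by
    have : (1 : ℝ) ≤ k := by exact_mod_cast hk
    linarith
  rw [tendsto_nhds_unique (tendsto_dirichletEta hk') hsum.tendsto_sum_nat]
  ring

theorem dirichletEta_two_mul_nonneg {k : ℕ} (hk : 1 ≤ k) : 0 ≤ dirichletEta (2 * (k : ℝ)) := by
  rw [dirichletEta_two_mul hk]
  refine mul_nonneg ?_ (evenZeta_nonneg k)
  have : (4 : ℝ) ^ 1 ≤ 4 ^ k := pow_le_pow_right₀ (by norm_num) hk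
  rw [sub_nonneg, div_le_one (by positivity)]
  linarith

/-- The power series of `log (tan t / t)`. -/
theorem hasSum_log_tan {t : ℝ} (ht : 0 < t) (ht' : t < Real.pi / 2) :
    HasSum (fun j : ℕ => dirichletEta (2 * ((j + 1 : ℕ) : ℝ)) *
        (4 ^ (j + 1) / (Real.pi ^ (2 * (j + 1)) * ((j : ℝ) + 1))) * t ^ (2 * (j + 1)))
      (Real.log (Real.tan t) - Real.log t) := by
  have hpi := Real.pi_pos
  have h1 := hasSum_log_sin (y := t / Real.pi) (by positivity)
    (by rw [div_lt_one hpi]; linarith)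
  have h2 := hasSum_log_sin (y := 2 * t / Real.pi) (by positivity)
    (by rw [div_lt_one hpi]; linarith)
  rw [mul_div_cancel₀ _ hpi.ne'] at h1 h2
  have hs : 0 < Real.sin t := Real.sin_pos_of_pos_of_lt_pi ht (by linarith)
  have hc : 0 < Real.cos t := Real.cos_pos_of_mem_Ioo ⟨by linarith, ht'⟩
  have h3 := h2.sub (h1.mul_left 2)
  -- This is `tan t = 2 sin² t / sin 2t` in logarithmic form.
  have e : -(Real.log (Real.sin (2 * t)) - Real.log (2 * t)) -
      2 * -(Real.log (Real.sin t) - Real.log t) = Real.log (Real.tan t) - Real.log t := by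
    rw [Real.sin_two_mul, Real.log_mul (by positivity) hc.ne', Real.log_mul two_ne_zero hs.ne',
      Real.log_mul two_ne_zero ht.ne', Real.tan_eq_sin_div_cos, Real.log_div hs.ne' hc.ne']
    ring
  rw [e] at h3
  refine h3.congr_fun fun j => ?_
  rw [dirichletEta_two_mul (by omega), div_pow, div_pow, mul_pow, pow_mul 2 2 (j + 1),
    show (2 : ℝ) ^ 2 = 4 by norm_num]
  field_simp

/-! ### Integrability and termwise integration. -/

theorem intervalIntegrable_log_tan (a b : ℝ) :
    IntervalIntegrable (fun t => Real.log (Real.tan t)) MeasureTheory.volume a b := by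
  -- At zeros of `sin` or `cos` the value of `tan` is `0` and `log 0 = 0`, so domination by `|log
  -- sin - log cos|` holds everywhere.
  have h : ∀ t, Real.log (Real.tan t) = 0 ∨
      Real.log (Real.tan t) = Real.log (Real.sin t) - Real.log (Real.cos t) := by
    intro t
    rw [Real.tan_eq_sin_div_cos]
    by_cases hs : Real.sin t = 0
    · simp [hs]
    by_cases hc : Real.cos t = 0
    · simp [hc]
    exact Or.inr (Real.log_div hs hc)
  have hi : IntervalIntegrable (fun t => Real.log (Real.sin t) - Real.log (Real.cos t))
      MeasureTheory.volume a b := intervalIntegrable_log_sin.sub intervalIntegrable_log_cos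
  refine hi.mono_fun ?_ ?_
  · refine (Measurable.log ?_).aestronglyMeasurable
    rw [funext Real.tan_eq_sin_div_cos]
    exact Real.measurable_sin.div Real.measurable_cos
  · refine Filter.Eventually.of_forall fun t => ?_
    rcases h t with h | h <;> simp [h]

theorem intervalIntegrable_mul_log_tan (x : ℝ) :
    IntervalIntegrable (fun t => t * Real.log (Real.tan t)) MeasureTheory.volume 0 x :=
  (intervalIntegrable_log_tan 0 x).continuousOn_mul continuousOn_id

theorem integral_mul_log {x : ℝ} (hx : 0 < x) :
    ∫ t in (0 : ℝ)..x, t * Real.log t = 1 / 4 * (2 * Real.log x - 1) * x ^ 2 := by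
  have hd : ∀ t ∈ Set.Ioo 0 x, HasDerivAt (fun t => t * (t * Real.log t) / 2 - t ^ 2 / 4)
      (t * Real.log t) t := by
    intro t ht
    have h := (((hasDerivAt_id t).mul ((hasDerivAt_id t).mul
      (Real.hasDerivAt_log ht.1.ne'))).div_const 2).sub (((hasDerivAt_id t).pow 2).div_const 4)
    refine h.congr_deriv ?_
    have := ht.1.ne'
    simp
    field_simp
    ring
  rw [intervalIntegral.integral_eq_sub_of_hasDerivAt_of_le hx.le _ hd
    (Real.continuous_mul_log.intervalIntegrable _ _)]
  · simp; ring
  · have := Real.continuous_mul_log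
    fun_prop

/-- Discards the right endpoint, since `hasSum_log_tan` requires `t < π / 2`. -/
theorem ae_mem_Ioo_of_mem_uIoc {a b : ℝ} (hab : a ≤ b) :
    ∀ᵐ t ∂(MeasureTheory.volume : MeasureTheory.Measure ℝ),
      t ∈ Set.uIoc a b → t ∈ Set.Ioo a b := by
  filter_upwards [MeasureTheory.Measure.ae_ne MeasureTheory.volume b] with t ht h
  rw [Set.uIoc_of_le hab] at h
  exact ⟨h.1, lt_of_le_of_ne h.2 ht⟩

/-- Termwise integration of the power series of `t * log (tan t / t)`. -/
theorem hasSum_integral_mul_log_tan {x : ℝ} (hx : 0 < x) (hx' : x ≤ Real.pi / 2) :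
    HasSum (fun j : ℕ => 2 ^ (2 * (j + 1) - 1) / (Real.pi ^ (2 * (j + 1)) * ((j + 1 : ℕ) : ℝ) *
        (((j + 1 : ℕ) : ℝ) + 1)) * dirichletEta (2 * ((j + 1 : ℕ) : ℝ)) * x ^ (2 * (j + 1) + 2))
      ((∫ t in (0 : ℝ)..x, t * Real.log (Real.tan t)) -
        1 / 4 * (2 * Real.log x - 1) * x ^ 2) := by
  set c : ℕ → ℝ := fun j => dirichletEta (2 * ((j + 1 : ℕ) : ℝ)) *
    (4 ^ (j + 1) / (Real.pi ^ (2 * (j + 1)) * ((j : ℝ) + 1))) with hc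
  have hc0 : ∀ j, 0 ≤ c j := fun j =>
    mul_nonneg (dirichletEta_two_mul_nonneg (by omega)) (by have := Real.pi_pos; positivity)
  have hlog : IntervalIntegrable (fun t : ℝ => t * Real.log t) MeasureTheory.volume 0 x :=
    Real.continuous_mul_log.intervalIntegrable _ _
  have hint := (intervalIntegrable_mul_log_tan x).sub hlog
  have hsum : ∀ᵐ t ∂(MeasureTheory.volume : MeasureTheory.Measure ℝ), t ∈ Set.uIoc 0 x →
      HasSum (fun j => c j * t ^ (2 * (j + 1) + 1))
        (t * Real.log (Real.tan t) - t * Real.log t) := by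
    filter_upwards [ae_mem_Ioo_of_mem_uIoc hx.le] with t ht h
    obtain ⟨h0, h1⟩ := ht h
    rw [← mul_sub]
    refine ((hasSum_log_tan h0 (h1.trans_le hx')).mul_left t).congr_fun fun j => ?_
    rw [pow_succ t (2 * (j + 1))]
    ring
  have key := intervalIntegral.hasSum_integral_of_dominated_convergence
    (μ := MeasureTheory.volume) (a := 0) (b := x) (F := fun j t => c j * t ^ (2 * (j + 1) + 1))
    (f := fun t => t * Real.log (Real.tan t) - t * Real.log t)
    -- The nonnegative terms are their own majorants; their sum is the integrable limit.
    (fun j t => c j * t ^ (2 * (j + 1) + 1))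
    (fun j => (by fun_prop : Continuous fun t : ℝ =>
      c j * t ^ (2 * (j + 1) + 1)).aestronglyMeasurable)
    (fun j => Filter.Eventually.of_forall fun t ht => by
      rw [Set.uIoc_of_le hx.le] at ht
      rw [Real.norm_of_nonneg (mul_nonneg (hc0 j) (pow_nonneg ht.1.le _))])
    (hsum.mono fun t ht h => (ht h).summable)
    (hint.congr_ae (by
      rw [Filter.EventuallyEq, MeasureTheory.ae_restrict_iff' measurableSet_uIoc]
      exact hsum.mono fun t ht h => (ht h).tsum_eq.symm)) hsum
  rw [intervalIntegral.integral_sub (intervalIntegrable_mul_log_tan x) hlog,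
    integral_mul_log hx] at key
  refine key.congr_fun fun j => ?_
  have h4 : (4 : ℝ) ^ (j + 1) = 2 * 2 ^ (2 * (j + 1) - 1) := by
    rw [← pow_succ', show 2 * (j + 1) - 1 + 1 = 2 * (j + 1) by omega, pow_mul]
    norm_num
  rw [intervalIntegral.integral_const_mul, integral_pow, hc]
  simp only [h4]
  push_cast
  have := Real.pi_pos.ne'
  field_simp
  ring_nf

/-! ### Fourier cosine coefficients of `log (tan t)`. -/

/-- The Dirichlet kernel `sin (n u) / sin u`, written as a sum of cosines. -/
noncomputable def sinKernel : ℕ → ℝ → ℝ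
  | 0, _ => 0
  | 1, _ => 1
  | n + 2, u => sinKernel n u + 2 * Real.cos (((n : ℝ) + 1) * u)

theorem sinKernel_mul_sin (n : ℕ) (u : ℝ) : sinKernel n u * Real.sin u = Real.sin (n * u) := by
  induction n using Nat.twoStepInduction with
  | zero => simp [sinKernel]
  | one => simp [sinKernel]
  | more n ih _ =>
    have h1 : ((n + 2 : ℕ) : ℝ) * u = ((n : ℝ) + 1) * u + u := by push_cast; ring
    have h2 : (n : ℝ) * u = ((n : ℝ) + 1) * u - u := by ring
    rw [sinKernel, add_mul, ih, h1, h2, Real.sin_add, Real.sin_sub]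
    ring

theorem continuous_sinKernel (n : ℕ) : Continuous (sinKernel n) := by
  induction n using Nat.twoStepInduction with
  | zero => exact continuous_const
  | one => exact continuous_const
  | more n ih _ =>
    simp only [funext fun u => (by rfl : sinKernel (n + 2) u =
      sinKernel n u + 2 * Real.cos (((n : ℝ) + 1) * u))]
    fun_prop

theorem integral_cos_two_mul {n : ℕ} (hn : n ≠ 0) :
    ∫ t in (0 : ℝ)..(Real.pi / 2), Real.cos (n * (2 * t)) = 0 := by
  have hn' : (n : ℝ) * 2 ≠ 0 := by positivity
  simp only [← mul_assoc]
  rw [intervalIntegral.integral_comp_mul_left (fun u => Real.cos u) hn', integral_cos,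
    show (n : ℝ) * 2 * (Real.pi / 2) = n * Real.pi by ring, Real.sin_nat_mul_pi]
  simp

theorem integral_sinKernel (n : ℕ) :
    ∫ t in (0 : ℝ)..(Real.pi / 2), sinKernel n (2 * t) = if Odd n then Real.pi / 2 else 0 := by
  induction n using Nat.twoStepInduction with
  | zero => simp [sinKernel]
  | one => simp [sinKernel]
  | more n ih _ =>
    have hk := continuous_sinKernel n
    have hodd : Odd (n + 2) ↔ Odd n := by simp [Nat.odd_add]
    have hc := integral_cos_two_mul (n := n + 1) n.succ_ne_zero
    push_cast at hc
    simp only [sinKernel, hodd]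
    rw [intervalIntegral.integral_add, intervalIntegral.integral_const_mul, hc, ih]
    · simp
    · exact Continuous.intervalIntegrable (by fun_prop) _ _
    · exact Continuous.intervalIntegrable (by fun_prop) _ _

/-- The Fourier cosine coefficients of `log (tan t)` on `[0, π / 2]`. -/
theorem integral_cos_mul_log_tan {n : ℕ} (hn : n ≠ 0) :
    ∫ t in (0 : ℝ)..(Real.pi / 2), Real.cos (n * (2 * t)) * Real.log (Real.tan t) =
      if Odd n then -(Real.pi / 2) / n else 0 := by
  have hn' : (n : ℝ) ≠ 0 := by positivity
  have hpi := Real.pi_pos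
  have hk := continuous_sinKernel n
  -- `G` is `sin (2nt) / (2n) * log (tan t)`, with `sin (2nt)` factored through the kernel so that
  -- each logarithm meets its own vanishing argument. This makes `G` continuous at both endpoints.
  set G : ℝ → ℝ := fun t => sinKernel n (2 * t) / n *
    (Real.cos t * (Real.sin t * Real.log (Real.sin t)) -
      Real.sin t * (Real.cos t * Real.log (Real.cos t))) with hG
  have hGc : Continuous G := by
    have h1 := Real.continuous_mul_log.comp Real.continuous_sin
    have h2 := Real.continuous_mul_log.comp Real.continuous_cos
    simp only [Function.comp_def] at h1 h2
    fun_prop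
  have hd : ∀ t ∈ Set.Ioo 0 (Real.pi / 2), HasDerivAt G
      (Real.cos (n * (2 * t)) * Real.log (Real.tan t) + sinKernel n (2 * t) / n) t := by
    intro t ht
    have hsin : ∀ s ∈ Set.Ioo 0 (Real.pi / 2), 0 < Real.sin s := fun s hs =>
      Real.sin_pos_of_pos_of_lt_pi hs.1 (by linarith [hs.2])
    have hcos : ∀ s ∈ Set.Ioo 0 (Real.pi / 2), 0 < Real.cos s := fun s hs =>
      Real.cos_pos_of_mem_Ioo ⟨by linarith [hs.1], hs.2⟩
    have hs := hsin t ht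
    have hc := hcos t ht
    have h1 : HasDerivAt (fun t : ℝ => Real.sin (n * (2 * t)) / (2 * n))
        (Real.cos (n * (2 * t))) t := by
      have := ((((hasDerivAt_id t).const_mul 2).const_mul (n : ℝ)).sin).div_const (2 * n)
      refine this.congr_deriv ?_
      simp only [id]
      field_simp
    have h2 : HasDerivAt (fun t : ℝ => Real.log (Real.sin t) - Real.log (Real.cos t))
        (Real.cos t / Real.sin t - -Real.sin t / Real.cos t) t :=
      ((Real.hasDerivAt_sin t).log hs.ne').sub ((Real.hasDerivAt_cos t).log hc.ne')
    have h3 := h1.mul h2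
    have hGe : G =ᶠ[𝓝 t] (fun t : ℝ => Real.sin (n * (2 * t)) / (2 * n)) *
        fun t : ℝ => Real.log (Real.sin t) - Real.log (Real.cos t) := by
      refine Filter.Eventually.of_forall fun s => ?_
      simp only [hG, Pi.mul_apply]
      rw [← sinKernel_mul_sin, Real.sin_two_mul]
      field_simp
    refine (h3.congr_of_eventuallyEq hGe).congr_deriv ?_
    rw [Real.tan_eq_sin_div_cos, Real.log_div hs.ne' hc.ne', ← sinKernel_mul_sin n (2 * t),
      Real.sin_two_mul]
    have := Real.sin_sq_add_cos_sq t
    field_simp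
    linear_combination sinKernel n (2 * t) * this
  have hi1 : IntervalIntegrable (fun t : ℝ => Real.cos (n * (2 * t)) * Real.log (Real.tan t))
      MeasureTheory.volume 0 (Real.pi / 2) :=
    (intervalIntegrable_log_tan 0 _).continuousOn_mul (by fun_prop)
  have hi2 : IntervalIntegrable (fun t : ℝ => sinKernel n (2 * t) / n)
      MeasureTheory.volume 0 (Real.pi / 2) := Continuous.intervalIntegrable (by fun_prop) _ _
  have key := intervalIntegral.integral_eq_sub_of_hasDerivAt_of_le (by positivity)
    hGc.continuousOn hd (hi1.add hi2)
  have h0 : G (Real.pi / 2) - G 0 = 0 := by simp [hG]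
  rw [h0, intervalIntegral.integral_add hi1 hi2, intervalIntegral.integral_div,
    integral_sinKernel] at key
  rw [eq_neg_of_add_eq_zero_left key]
  split_ifs <;> ring

/-! ### The integral up to `π / 2` and `ζ(3)`. -/

theorem hasSum_cos_div_sq {t : ℝ} (ht : t ∈ Set.Icc 0 (Real.pi / 2)) :
    HasSum (fun n : ℕ => 1 / (n : ℝ) ^ 2 * Real.cos (n * (2 * t)))
      (t ^ 2 - Real.pi * t + Real.pi ^ 2 / 6) := by
  have hpi := Real.pi_pos
  have h := hasSum_one_div_nat_pow_mul_cos (k := 1) one_ne_zero (x := t / Real.pi)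
    ⟨div_nonneg ht.1 hpi.le, by rw [div_le_one hpi]; linarith [ht.2]⟩
  have hb : Polynomial.eval (t / Real.pi) (Polynomial.map (algebraMap ℚ ℝ)
      (Polynomial.bernoulli (2 * 1))) = (t / Real.pi) ^ 2 - t / Real.pi + 1 / 6 := by
    simp [Polynomial.bernoulli_def, Finset.sum_range_succ, bernoulli_one, bernoulli_two]
    ring
  rw [hb] at h
  convert h using 1
  · ext n
    congr 2
    field_simp
  · norm_num [Nat.factorial]
    field_simp

/-- Functions symmetric about `π / 4` are orthogonal to `log (tan t)`. -/
theorem integral_symm_mul_log_tan {q : ℝ → ℝ} (hq : ∀ t, q (Real.pi / 2 - t) = q t) :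
    ∫ t in (0 : ℝ)..(Real.pi / 2), q t * Real.log (Real.tan t) = 0 := by
  have h := intervalIntegral.integral_comp_sub_left (a := 0) (b := Real.pi / 2)
    (fun t => q t * Real.log (Real.tan t)) (Real.pi / 2)
  simp only [hq, Real.tan_pi_div_two_sub, Real.log_inv, mul_neg, sub_self, sub_zero,
    intervalIntegral.integral_neg] at h
  linarith

theorem hasSum_odd_inv_cube :
    HasSum (fun n : ℕ => if Odd n then 1 / (n : ℝ) ^ 3 else 0)
      (∫ t in (0 : ℝ)..(Real.pi / 2), t * Real.log (Real.tan t)) := by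
  have hpi := Real.pi_pos
  have hL := intervalIntegrable_log_tan 0 (Real.pi / 2)
  have hsq : Summable (fun n : ℕ => 1 / (n : ℝ) ^ 2) :=
    Real.summable_one_div_nat_pow.2 (by norm_num)
  have key := intervalIntegral.hasSum_integral_of_dominated_convergence
    (μ := MeasureTheory.volume) (a := 0) (b := Real.pi / 2)
    (F := fun (n : ℕ) t => 1 / (n : ℝ) ^ 2 * (Real.cos (n * (2 * t)) * Real.log (Real.tan t)))
    (f := fun t => (t ^ 2 - Real.pi * t + Real.pi ^ 2 / 6) * Real.log (Real.tan t))
    (fun n t => 1 / (n : ℝ) ^ 2 * |Real.log (Real.tan t)|)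
    (fun n => by
      have : IntervalIntegrable (fun t : ℝ => 1 / (n : ℝ) ^ 2 *
          (Real.cos (n * (2 * t)) * Real.log (Real.tan t))) MeasureTheory.volume 0 (Real.pi / 2) :=
        (hL.continuousOn_mul (by fun_prop)).const_mul _
      exact this.def'.aestronglyMeasurable)
    (fun n => Filter.Eventually.of_forall fun t _ => by
      rw [norm_mul, norm_mul, Real.norm_of_nonneg (by positivity : 0 ≤ 1 / (n : ℝ) ^ 2)]
      gcongr
      exact mul_le_of_le_one_left (abs_nonneg _) (Real.abs_cos_le_one _))
    (Filter.Eventually.of_forall fun t _ => hsq.mul_right _)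
    (by
      simp only [tsum_mul_right]
      exact hL.abs.const_mul _)
    (Filter.Eventually.of_forall fun t ht => by
      rw [Set.uIoc_of_le (by positivity)] at ht
      simpa only [mul_assoc] using
        (hasSum_cos_div_sq ⟨ht.1.le, ht.2⟩).mul_right (Real.log (Real.tan t)))
  -- This `q` is the quadratic plus `(π / 2) t`, which makes it symmetric about `π / 4`.
  have hq := integral_symm_mul_log_tan
    (q := fun t => t ^ 2 - Real.pi / 2 * t + Real.pi ^ 2 / 6) (fun t => by ring)
  have hsplit : ∫ t in (0 : ℝ)..(Real.pi / 2),
      (t ^ 2 - Real.pi * t + Real.pi ^ 2 / 6) * Real.log (Real.tan t) =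
      -(Real.pi / 2) * ∫ t in (0 : ℝ)..(Real.pi / 2), t * Real.log (Real.tan t) := by
    rw [← intervalIntegral.integral_const_mul]
    refine Eq.trans ?_ ((congrArg _ hq).trans (add_zero _))
    rw [← intervalIntegral.integral_add]
    · congr 1 with t
      ring
    · exact (intervalIntegrable_mul_log_tan _).const_mul _
    · exact hL.continuousOn_mul (by fun_prop)
  rw [hsplit] at key
  have := key.mul_left (-(Real.pi / 2))⁻¹
  rw [inv_mul_cancel_left₀ (by simp [hpi.ne'])] at this
  refine this.congr_fun fun n => ?_
  rw [intervalIntegral.integral_const_mul]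
  rcases eq_or_ne n 0 with rfl | hn
  · simp
  rw [integral_cos_mul_log_tan hn]
  have hn' : (n : ℝ) ≠ 0 := by positivity
  split_ifs
  · field_simp
  · simp

theorem zeta_three_eq_integral : riemannZeta 3 =
    ((8 / 7 * ∫ t in (0 : ℝ)..(Real.pi / 2), t * Real.log (Real.tan t) : ℝ) : ℂ) := by
  have hs : HasSum (fun n : ℕ => 1 / (n : ℝ) ^ 3) (∑' n : ℕ, 1 / (n : ℝ) ^ 3) :=
    (Real.summable_one_div_nat_pow.2 (by norm_num)).hasSum
  have heven := hs.div_const 8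
  have hz : riemannZeta 3 = ((∑' n : ℕ, 1 / (n : ℝ) ^ 3 : ℝ) : ℂ) := by
    have := zeta_nat_eq_tsum_of_gt_one (k := 3) (by norm_num)
    push_cast at this ⊢
    exact this
  -- Even `n` contribute `ζ(3) / 8`, leaving `7/8` for the odd ones.
  have hE : HasSum (fun n : ℕ => if Odd n then 0 else 1 / (n : ℝ) ^ 3)
      ((∑' n : ℕ, 1 / (n : ℝ) ^ 3) / 8 + 0) := by
    refine HasSum.even_add_odd (heven.congr_fun fun n => ?_) (hasSum_zero.congr_fun fun n => ?_)
    · rw [if_neg (Nat.not_odd_iff_even.2 (even_two_mul n))]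
      push_cast
      rw [mul_pow]
      field_simp
      norm_num
    · simp
  have := (hE.add hasSum_odd_inv_cube).unique (hs.congr_fun fun n => by split_ifs <;> simp)
  rw [hz]
  congr 1
  linarith

theorem mainTheorem8 :
    (Summable (fun j : ℕ+ => dirichletEta (2 * (j : ℝ)) / ((j : ℝ) * ((j : ℝ) + 1))) ∧
      riemannZeta 3 =
        ((Real.pi ^ 2 / 7 * (Real.log (Real.pi / 2) - 1 / 2 +
          ∑' j : ℕ+, dirichletEta (2 * (j : ℝ)) / ((j : ℝ) * ((j : ℝ) + 1))) : ℝ) : ℂ)) ∧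
    (∀ x : ℝ, 0 < x → x ≤ Real.pi / 2 →
      IntervalIntegrable (fun t : ℝ => t * Real.log (Real.tan t)) MeasureTheory.volume 0 x ∧
      Summable (fun j : ℕ+ =>
        2 ^ (2 * (j : ℕ) - 1) / (Real.pi ^ (2 * (j : ℕ)) * (j : ℝ) * ((j : ℝ) + 1)) *
          dirichletEta (2 * (j : ℝ)) * x ^ (2 * (j : ℕ) + 2)) ∧
      8 / 7 * ∫ t in (0 : ℝ)..x, t * Real.log (Real.tan t) =
        8 / 7 * (1 / 4 * (2 * Real.log x - 1) * x ^ 2 +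
          ∑' j : ℕ+,
            2 ^ (2 * (j : ℕ) - 1) / (Real.pi ^ (2 * (j : ℕ)) * (j : ℝ) * ((j : ℝ) + 1)) *
              dirichletEta (2 * (j : ℝ)) * x ^ (2 * (j : ℕ) + 2))) ∧
    riemannZeta 3 =
      ((8 / 7 * ∫ t in (0 : ℝ)..(Real.pi / 2), t * Real.log (Real.tan t) : ℝ) : ℂ) := by
  have hpi := Real.pi_pos
  have hP : ∀ x : ℝ, 0 < x → x ≤ Real.pi / 2 → HasSum (fun j : ℕ+ =>
        2 ^ (2 * (j : ℕ) - 1) / (Real.pi ^ (2 * (j : ℕ)) * (j : ℝ) * ((j : ℝ) + 1)) *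
          dirichletEta (2 * (j : ℝ)) * x ^ (2 * (j : ℕ) + 2))
      ((∫ t in (0 : ℝ)..x, t * Real.log (Real.tan t)) -
        1 / 4 * (2 * Real.log x - 1) * x ^ 2) := fun x hx hx' => by
    rw [← Equiv.pnatEquivNat.symm.hasSum_iff]
    exact hasSum_integral_mul_log_tan hx hx'
  have hη : HasSum (fun j : ℕ+ => dirichletEta (2 * (j : ℝ)) / ((j : ℝ) * ((j : ℝ) + 1)))
      (8 / Real.pi ^ 2 * ((∫ t in (0 : ℝ)..(Real.pi / 2), t * Real.log (Real.tan t)) -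
        1 / 4 * (2 * Real.log (Real.pi / 2) - 1) * (Real.pi / 2) ^ 2)) := by
    -- At `x = π / 2` the powers of `2` and `π` in each term collapse to `π² / 8`.
    refine ((hP _ (by positivity) le_rfl).mul_left (8 / Real.pi ^ 2)).congr_fun fun j => ?_
    have hj : (2 : ℝ) ^ (2 * (j : ℕ)) = 2 * 2 ^ (2 * (j : ℕ) - 1) := by
      rw [← pow_succ']
      congr 1
      have := j.pos
      omega
    have hj0 : (j : ℝ) ≠ 0 := by exact_mod_cast j.ne_zero
    rw [div_pow, pow_add, pow_add, hj]
    field_simp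
    ring
  refine ⟨⟨hη.summable, ?_⟩, fun x hx hx' => ⟨intervalIntegrable_mul_log_tan x,
    (hP x hx hx').summable, ?_⟩, zeta_three_eq_integral⟩
  · rw [hη.tsum_eq, zeta_three_eq_integral]
    congr 1
    field_simp
    ring
  · rw [(hP x hx hx').tsum_eq]
    ring
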